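/- Let $(X,d)$ be a compact metric space with base point $\bullet\in X$, and let $R>0$ be such that $X$ is simply connected up to scale $R$, i.e. for every $x\in X$ and every $0<r<R$ the open ball $\{y\in X : d(x,y)<r\}$ is simply connected (in particular path connected). For $r>0$ let $\mathrm{Rips}(X,r)$ be the (open) Rips complex: the abstract simplicial complex with vertex set $X$ whose simplices are the nonempty finite subsets $\sigma\subseteq X$ with $\operatorname{Diam}(\sigma)<r$; its fundamental group is that of its geometric realization (with the weak topology), based at the vertex $\bullet$. Then 1. $\pi_1(\mathrm{Rips}(X,r),\bullet)\cong\pi_1(X,\bullet)$ for every $r$ with $0<r<R/3$; 2. for all $0<r<r'<R/3$ the natural inclusion $i_{r,r'}\colon \mathrm{Rips}(X,r)\hookrightarrow\mathrm{Rips}(X,r')$ induces an isomorphism $\pi_1(\mathrm{Rips}(X,r),\bullet)\to\pi_1(\mathrm{Rips}(X,r'),\bullet)$. -/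

import Mathlib

noncomputable section

/-- The open Rips complex `Rips(X, r)`: the simplices are the nonempty finite subsets of `X` of
diameter `< r`. (For `r ≤ 0` there are none; for `r > 0` every point of `X` is a vertex.) -/
def ripsComplex (X : Type*) [MetricSpace X] (r : ℝ) : PreAbstractSimplicialComplex X where
  faces := {s | s.Nonempty ∧ Metric.diam (s : Set X) < r}
  isRelLowerSet_faces := fun s hs => ⟨hs.1, fun _ hts ht => ⟨ht,
    (Metric.diam_mono (Finset.coe_subset.mpr hts) s.finite_toSet.isBounded).trans_lt hs.2⟩⟩

namespace PreAbstractSimplicialComplex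

variable {V : Type*}

/-- The points of the geometric realization `|K|`, in barycentric coordinates: finitely supported
nonnegative functions on the vertices, with total mass `1` and whose support is a simplex. -/
@[ext]
structure Realization (K : PreAbstractSimplicialComplex V) where
  /-- The barycentric coordinates. -/
  coord : V →₀ ℝ
  support_mem : coord.support ∈ K
  nonneg : ∀ v, 0 ≤ coord v
  sum_eq_one : (coord.sum fun _ a => a) = 1

/-- The closed simplex of `|K|` spanned by `s`. -/
@[ext]
structure ClosedSimplex (K : PreAbstractSimplicialComplex V) (s : Finset V) where
  /-- The underlying point of `|K|`. -/
  point : K.Realization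
  support_subset : point.coord.support ⊆ s

/-- A closed simplex carries its Euclidean topology, that of its barycentric coordinates. -/
instance (K : PreAbstractSimplicialComplex V) (s : Finset V) :
    TopologicalSpace (K.ClosedSimplex s) :=
  TopologicalSpace.induced (fun x => (fun v => x.point.coord v : V → ℝ)) inferInstance

/-- The weak (coherent) topology on `|K|`: the finest topology for which the inclusion of every
closed simplex is continuous. -/
instance (K : PreAbstractSimplicialComplex V) : TopologicalSpace K.Realization :=
  ⨆ s : {s : Finset V // s ∈ K},
    TopologicalSpace.coinduced (ClosedSimplex.point (K := K) (s := s.1)) inferInstance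

/-- A vertex of `K` as a point of `|K|`. -/
def vertex (K : PreAbstractSimplicialComplex V) (v : V) (hv : {v} ∈ K) : K.Realization where
  coord := Finsupp.single v 1
  support_mem := by rwa [Finsupp.support_single v one_ne_zero]
  nonneg w := by classical rw [Finsupp.single_apply]; split_ifs <;> norm_num
  sum_eq_one := by simp

/-- The inclusion `|K| ↪ |L|` of a subcomplex. -/
def inclusion {K L : PreAbstractSimplicialComplex V} (h : K ≤ L) :
    C(K.Realization, L.Realization) where
  toFun x := ⟨x.coord, h x.support_mem, x.nonneg, x.sum_eq_one⟩
  continuous_toFun := by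
    refine continuous_iSup_dom.2 fun s => continuous_coinduced_dom.2 ?_
    have h1 : Continuous (ClosedSimplex.point (K := L) (s := s.1)) :=
      continuous_iff_coinduced_le.2 (le_iSup (fun t : {t : Finset V // t ∈ L} =>
        TopologicalSpace.coinduced (ClosedSimplex.point (K := L) (s := t.1)) inferInstance)
        ⟨s.1, h s.2⟩)
    have h2 : Continuous (fun x : K.ClosedSimplex s.1 =>
        (⟨⟨x.point.coord, h x.point.support_mem, x.point.nonneg, x.point.sum_eq_one⟩,
          x.support_subset⟩ : L.ClosedSimplex s.1)) :=
      continuous_induced_rng.2 continuous_induced_dom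
    exact h1.comp h2

end PreAbstractSimplicialComplex

/-- The base point: the vertex `x` of `|Rips(X, r)|`. -/
def ripsVertex {X : Type*} [MetricSpace X] {r : ℝ} (hr : 0 < r) (x : X) :
    (ripsComplex X r).Realization :=
  (ripsComplex X r).vertex x ⟨Finset.singleton_nonempty x, by simpa using hr⟩

/-- The natural inclusion `i_{r,r'} : |Rips(X, r)| ↪ |Rips(X, r')|` for `r ≤ r'`. -/
def ripsInclusion (X : Type*) [MetricSpace X] {r r' : ℝ} (h : r ≤ r') :
    C((ripsComplex X r).Realization, (ripsComplex X r').Realization) :=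
  PreAbstractSimplicialComplex.inclusion fun _ hs => ⟨hs.1, hs.2.trans_le h⟩

theorem ripsInclusion_vertex {X : Type*} [MetricSpace X] {r r' : ℝ} (hr : 0 < r) (h : r ≤ r')
    (x : X) : ripsInclusion X h (ripsVertex hr x) = ripsVertex (hr.trans_le h) x := rfl

/-- `X` is simply connected up to scale `R`: every open ball of radius `0 < r < R` is simply
connected. -/
def SimplyConnectedUpToScale (X : Type*) [MetricSpace X] (R : ℝ) : Prop :=
  ∀ (x : X) (r : ℝ), 0 < r → r < R → IsSimplyConnected (Metric.ball x r)

end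

/-! Homomorphisms out of a fundamental group are handled as functors from the fundamental groupoid
to a group (`PathHom`), because such functors are local. By Lebesgue subdivision, a cocycle given on
the members of an open cover extends to all paths (`exists_pathHom_of_cocycle`). Two functors that
agree up to a coboundary on paths inside the members agree up to it on every path in the component
of the base point (`PathHom.eq_of_local`).

From `X` to the complex, cover `X` by balls of radius `r / 2` and replace a path inside one by the
edge between its ends; the triangles of the complex give the cocycle identity. This defines
`toRips`.

Back from the complex to `X`, cover it by open stars and send each point to a vertex of its carrier.
A path in the star of `v` then becomes a path in the ball of radius `r` about `v`. Any choice will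
do, since this ball lies in the ball of radius `2 * r` about each of its points, which is simply
connected as `2 * r < R`.

Both composites agree locally with the identity up to a coboundary that is trivial at the base
point, so the two maps are mutually inverse (`toRips_injective`, `toRips_surjective`). On the
complex this uses that a path in an open star is equivalent to the broken line through its centre
(`map_eq_of_mem_openStar`). Finally `toRips` commutes with the inclusions (`mapOfEq_comp_toRips`),
so these are isomorphisms by cancellation. -/

open Set Topology unitInterval PreAbstractSimplicialComplex

/-! ### Group-valued functors on the fundamental groupoid. -/

/-- A homotopy-invariant assignment of group elements to paths which reverses concatenation, that
is, a functor from the fundamental groupoid of `Y` to `G` (the order matches the multiplication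
`p * q = q.trans p` of `FundamentalGroup`). -/
structure PathHom (Y G : Type*) [TopologicalSpace Y] [Group G] where
  /-- The value on a path. -/
  toFun : ∀ {x y : Y}, Path x y → G
  map_homotopic : ∀ {x y : Y} {p q : Path x y}, p.Homotopic q → toFun p = toFun q
  map_trans : ∀ {x y z : Y} (p : Path x y) (q : Path y z), toFun (p.trans q) = toFun q * toFun p

namespace PathHom

variable {Y Z G H : Type*} [TopologicalSpace Y] [TopologicalSpace Z] [Group G] [Group H]

instance : CoeFun (PathHom Y G) (fun _ => ∀ {x y : Y}, Path x y → G) := ⟨@toFun Y G _ _⟩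

theorem map_refl (T : PathHom Y G) (x : Y) : T (Path.refl x) = 1 := by
  have h := T.map_trans (Path.refl x) (Path.refl x)
  rw [Path.refl_trans_refl] at h
  exact left_eq_mul.mp h

theorem map_symm (T : PathHom Y G) {x y : Y} (p : Path x y) : T p.symm = (T p)⁻¹ := by
  rw [eq_inv_iff_mul_eq_one, ← T.map_trans, ← T.map_refl x]
  exact T.map_homotopic ⟨(Path.Homotopy.reflTransSymm p).symm⟩

theorem map_cast (T : PathHom Y G) {x y x' y' : Y} (p : Path x y) (hx : x' = x) (hy : y' = y) :
    T (p.cast hx hy) = T p := by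
  subst hx hy; rfl

/-- The trivial assignment. -/
def trivial : PathHom Y G where
  toFun _ := 1
  map_homotopic _ := rfl
  map_trans _ _ := (mul_one 1).symm

/-- Restriction along a continuous map. -/
def comap (T : PathHom Y G) (f : C(Z, Y)) : PathHom Z G where
  toFun p := T (p.map f.continuous)
  map_homotopic h := T.map_homotopic (h.map f)
  map_trans p q := by rw [Path.map_trans, T.map_trans]

/-- Composition with a group homomorphism. -/
def comp (T : PathHom Y G) (f : G →* H) : PathHom Y H where
  toFun p := f (T p)
  map_homotopic h := by rw [T.map_homotopic h]
  map_trans p q := by rw [T.map_trans, map_mul]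

/-- The induced homomorphism on the fundamental group. -/
def toMonoidHom (T : PathHom Y G) (y₀ : Y) : FundamentalGroup Y y₀ →* G where
  toFun := Quotient.lift (s := Path.Homotopic.setoid y₀ y₀) (fun p => T p)
    fun _ _ h => T.map_homotopic h
  map_one' := T.map_refl y₀
  map_mul' := by
    rintro ⟨p⟩ ⟨q⟩
    exact T.map_trans q p

/-- The class of a loop in the fundamental group. -/
def loopClass {y : Y} (p : Path y y) : FundamentalGroup Y y := Path.Homotopic.Quotient.mk p

theorem toMonoidHom_loopClass (T : PathHom Y G) {y : Y} (p : Path y y) :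
    T.toMonoidHom y (loopClass p) = T p := rfl

theorem loopClass_surjective (y : Y) : Function.Surjective (loopClass (y := y)) :=
  Path.Homotopic.Quotient.mk_surjective

open Classical in
/-- A chosen path from the base point, constant at the base point itself. -/
noncomputable def basePath {y₀ y : Y} (h : Joined y₀ y) : Path y₀ y :=
  if e : y = y₀ then (Path.refl y₀).cast rfl e else h.somePath

theorem basePath_self {y₀ : Y} (h : Joined y₀ y₀) : basePath h = Path.refl y₀ := by
  simp [basePath]

open Classical in
/-- Paths in the component of `y₀`, closed up to loops at `y₀` by means of the chosen paths. -/
noncomputable def loop (y₀ : Y) : PathHom Y (FundamentalGroup Y y₀) where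
  -- Both ends of a path lie in the same component, so the value `1` outside the component of `y₀`
  -- respects concatenation.
  toFun {x y} p := if h : Joined y₀ x then
    loopClass (((basePath h).trans p).trans (basePath (h.trans ⟨p⟩)).symm) else 1
  map_homotopic {x y p q} h := by
    split_ifs with hx
    · exact Path.Homotopic.Quotient.eq.2 (((Path.Homotopic.refl _).hcomp h).hcomp (.refl _))
    · rfl
  map_trans {x y z} p q := by
    by_cases hx : Joined y₀ x
    · have hy : Joined y₀ y := hx.trans ⟨p⟩
      rw [dif_pos hx, dif_pos hx, dif_pos hy, FundamentalGroup.mul_def]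
      simp only [loopClass, Path.Homotopic.Quotient.mk_trans, Path.Homotopic.Quotient.mk_symm,
        Path.Homotopic.Quotient.trans_assoc]
      congr 2
      rw [← Path.Homotopic.Quotient.trans_assoc (Path.Homotopic.Quotient.symm _),
        Path.Homotopic.Quotient.symm_trans, Path.Homotopic.Quotient.refl_trans]
    · have hy : ¬ Joined y₀ y := fun hy => hx (hy.trans ⟨p.symm⟩)
      simp [hx, hy]

theorem loop_apply_loop {y₀ : Y} (p : Path y₀ y₀) : loop y₀ p = loopClass p := by
  simp only [loop, dif_pos (Joined.refl y₀), basePath_self]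
  simp [loopClass]

open Classical in
/-- The values of `T` on the chosen paths. -/
noncomputable def potential (T : PathHom Y G) (y₀ y : Y) : G :=
  if h : Joined y₀ y then T (basePath h) else 1

theorem potential_self (T : PathHom Y G) (y₀ : Y) : T.potential y₀ y₀ = 1 := by
  rw [potential, dif_pos (Joined.refl y₀), basePath_self, T.map_refl]

/-- The connecting paths used by `loop` contribute the potential at the two ends: up to this
coboundary, every functor factors through `loop`. -/
theorem toMonoidHom_loop (T : PathHom Y G) {y₀ x y : Y} (h : Joined y₀ x) (p : Path x y) :
    T.toMonoidHom y₀ (loop y₀ p) = (T.potential y₀ y)⁻¹ * T p * T.potential y₀ x := by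
  simp only [loop, dif_pos h, potential, dif_pos (h.trans ⟨p⟩), toMonoidHom_loopClass]
  rw [T.map_trans, T.map_trans, T.map_symm, mul_assoc]

/-- Two assignments that agree up to a coboundary on the paths inside the members of an open cover
agree up to this coboundary everywhere. -/
theorem eq_of_local {ι : Type*} {U : ι → Set Y} (hU : ∀ i, IsOpen (U i)) (hcov : ∀ y, ∃ i, y ∈ U i)
    (A B : PathHom Y G) (b : Y → G) (y₀ : Y)
    (h : ∀ i {x y : Y} (p : Path x y), Joined y₀ x → (∀ t, p t ∈ U i) →
      A p = b y * B p * (b x)⁻¹)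
    {x y : Y} (p : Path x y) (hx : Joined y₀ x) : A p = b y * B p * (b x)⁻¹ := by
  obtain ⟨t, ht0, hmono, ⟨m, hm⟩, ht⟩ := exists_monotone_Icc_subset_open_cover_unitInterval
    (c := fun i => p ⁻¹' U i) (fun i => (hU i).preimage p.continuous)
    (fun s _ => mem_iUnion.2 (hcov (p s)))
  -- Along the subdivision the factors `b (p (t n))` cancel between consecutive pieces.
  have key : ∀ n, A (p.subpath 0 (t n)) =
      b (p (t n)) * B (p.subpath 0 (t n)) * (b (p 0))⁻¹ := by
    intro n
    induction n with
    | zero => rw [ht0, Path.subpath_self, A.map_refl, B.map_refl]; group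
    | succ n ih =>
      have hom : ((p.subpath 0 (t n)).trans (p.subpath (t n) (t (n + 1)))).Homotopic
        (p.subpath 0 (t (n + 1))) := ⟨Path.Homotopy.subpathTransSubpath p _ _ _⟩
      obtain ⟨i, hi⟩ := ht n
      have hJ : Joined y₀ (p (t n)) := by
        have h0 : Joined y₀ (p 0) := by rwa [p.source]
        exact h0.trans ⟨p.subpath 0 (t n)⟩
      have hs := h i (p.subpath (t n) (t (n + 1))) hJ (fun s => by
        have : p.subpath (t n) (t (n + 1)) s ∈ range (p.subpath (t n) (t (n + 1))) := ⟨s, rfl⟩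
        rw [Path.range_subpath_of_le _ _ _ (hmono n.le_succ)] at this
        obtain ⟨s', hs', e⟩ := this
        rw [← e]
        exact hi hs')
      rw [← A.map_homotopic hom, ← B.map_homotopic hom, A.map_trans, B.map_trans, ih, hs]
      group
  have := key m
  rw [hm m le_rfl] at this
  rw [Path.subpath_zero_one, A.map_cast, B.map_cast] at this
  simpa using this

end PathHom

/-! ### Products of a cocycle along sequences of points. -/

/-- The product of the values of `g` along the first `n` steps of a sequence. -/
def seqProd {Y G : Type*} [Group G] (g : Y → Y → G) (u : ℕ → Y) : ℕ → G
  | 0 => 1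
  | n + 1 => g (u n) (u (n + 1)) * seqProd g u n

section Cocycle

variable {ι Y G : Type*} [Group G] {g : Y → Y → G} {U : ι → Set Y}

theorem seqProd_congr {u w : ℕ → Y} {n : ℕ} (h : ∀ k ≤ n, u k = w k) :
    seqProd g u n = seqProd g w n := by
  induction n with
  | zero => rfl
  | succ n ih =>
    rw [seqProd, seqProd, ih fun k hk => h k (hk.trans n.le_succ), h n n.le_succ, h _ le_rfl]

theorem seqProd_add (u : ℕ → Y) (m n : ℕ) :
    seqProd g u (m + n) = seqProd g (fun k => u (m + k)) n * seqProd g u m := by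
  induction n with
  | zero => simp [seqProd]
  | succ n ih => rw [← add_assoc, seqProd, ih, seqProd, mul_assoc, add_assoc]

theorem cocycle_self (hg : ∀ i, ∀ a ∈ U i, ∀ b ∈ U i, ∀ c ∈ U i, g b c * g a b = g a c)
    {i : ι} {a : Y} (ha : a ∈ U i) : g a a = 1 :=
  mul_eq_left.mp (hg i a ha a ha a ha)

theorem seqProd_of_mem (hg : ∀ i, ∀ a ∈ U i, ∀ b ∈ U i, ∀ c ∈ U i, g b c * g a b = g a c)
    {i : ι} {u : ℕ → Y} {n : ℕ} (h : ∀ k ≤ n, u k ∈ U i) : seqProd g u n = g (u 0) (u n) := by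
  induction n with
  | zero => exact (cocycle_self hg (h 0 le_rfl)).symm
  | succ n ih =>
    rw [seqProd, ih fun k hk => h k (hk.trans n.le_succ)]
    exact hg i _ (h 0 (Nat.zero_le _)) _ (h n n.le_succ) _ (h _ le_rfl)

/-- Each block of `m` steps stays in one member of the cover, where the cocycle identity telescopes
it to a single factor. -/
theorem seqProd_mul (hg : ∀ i, ∀ a ∈ U i, ∀ b ∈ U i, ∀ c ∈ U i, g b c * g a b = g a c)
    {u : ℕ → Y} {n m : ℕ} (h : ∀ k < n, ∃ i, ∀ j ≤ m, u (k * m + j) ∈ U i) :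
    seqProd g u (n * m) = seqProd g (fun k => u (k * m)) n := by
  induction n with
  | zero => simp [seqProd]
  | succ n ih =>
    obtain ⟨i, hi⟩ := h n n.lt_succ_self
    rw [Nat.succ_mul, seqProd_add, ih fun k hk => h k (hk.trans n.lt_succ_self),
      seqProd_of_mem hg hi, seqProd, Nat.succ_mul, add_zero]

/-- In each cell the diagonal value `g (u k) (w (k + 1))` is computed along both pairs of sides,
which moves the rung one step along. -/
theorem seqProd_ladder (hg : ∀ i, ∀ a ∈ U i, ∀ b ∈ U i, ∀ c ∈ U i, g b c * g a b = g a c)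
    {u w : ℕ → Y} {n : ℕ} (h0 : g (u 0) (w 0) = 1)
    (h : ∀ k < n, ∃ i, u k ∈ U i ∧ u (k + 1) ∈ U i ∧ w k ∈ U i ∧ w (k + 1) ∈ U i) :
    g (u n) (w n) * seqProd g u n = seqProd g w n := by
  induction n with
  | zero => simpa [seqProd] using h0
  | succ n ih =>
    obtain ⟨i, h1, h2, h3, h4⟩ := h n n.lt_succ_self
    rw [seqProd, seqProd, ← ih fun k hk => h k (hk.trans n.lt_succ_self), ← mul_assoc, ← mul_assoc,
      hg i _ h1 _ h2 _ h4, hg i _ h1 _ h3 _ h4]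

end Cocycle

/-! ### Fine subdivisions and the extension of cocycles to paths. -/

/-- `n` equal subdivisions of the unit interval refine the cover `U` along `f`. -/
def IsFine {ι Y : Type*} (U : ι → Set Y) (f : ℝ → Y) (n : ℕ) : Prop :=
  0 < n ∧ ∀ k < n, ∃ i, ∀ t : ℝ, k ≤ t * n → t * n ≤ k + 1 → f t ∈ U i

theorem exists_fine_grid {ι Y : Type*} [TopologicalSpace Y] {U : ι → Set Y}
    (hU : ∀ i, IsOpen (U i)) (hcov : ∀ y, ∃ i, y ∈ U i) {f : ℝ × ℝ → Y} (hf : Continuous f) :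
    ∃ n : ℕ, 0 < n ∧ ∀ j < n, ∀ k < n, ∃ i, ∀ s t : ℝ, j ≤ s * n → s * n ≤ j + 1 →
      k ≤ t * n → t * n ≤ k + 1 → f (s, t) ∈ U i := by
  obtain ⟨δ, hδ, h⟩ := lebesgue_number_lemma_of_metric
    (s := Icc (0 : ℝ) 1 ×ˢ Icc (0 : ℝ) 1) (isCompact_Icc.prod isCompact_Icc)
    (c := fun i => f ⁻¹' U i) (fun i => (hU i).preimage hf)
    (fun s _ => mem_iUnion.2 (hcov (f s)))
  obtain ⟨m, hm⟩ := exists_nat_one_div_lt hδ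
  refine ⟨m + 1, m.succ_pos, fun j hj k hk => ?_⟩
  have hm0 : (0 : ℝ) < (m + 1 : ℕ) := by positivity
  have hmem : ∀ j < m + 1, (j : ℝ) / (m + 1 : ℕ) ∈ Icc (0 : ℝ) 1 := fun j hj =>
    ⟨by positivity, (div_le_one hm0).2 (by exact_mod_cast hj.le)⟩
  have hdist : ∀ (j : ℕ) (s : ℝ), j ≤ s * (m + 1 : ℕ) → s * (m + 1 : ℕ) ≤ j + 1 →
      dist s ((j : ℝ) / (m + 1 : ℕ)) < δ := by
    intro j s h1 h2
    refine lt_of_le_of_lt ?_ hm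
    have h3 : (j : ℝ) / (m + 1 : ℕ) ≤ s := (div_le_iff₀ hm0).2 h1
    have h4 : s ≤ ((j : ℝ) + 1) / (m + 1 : ℕ) := (le_div_iff₀ hm0).2 h2
    rw [Real.dist_eq, abs_of_nonneg (by linarith)]
    rw [add_div] at h4
    push_cast at h4 ⊢
    linarith
  -- In the sup metric the `δ`-ball about the lower left corner contains the whole cell, whose side
  -- is less than `δ`.
  obtain ⟨i, hi⟩ := h ((j : ℝ) / (m + 1 : ℕ), (k : ℝ) / (m + 1 : ℕ)) ⟨hmem j hj, hmem k hk⟩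
  refine ⟨i, fun s t h1 h2 h3 h4 => hi ?_⟩
  rw [Metric.mem_ball, Prod.dist_eq]
  exact max_lt (hdist j s h1 h2) (hdist k t h3 h4)

section Subdivision

variable {ι Y G : Type*} [Group G] {g : Y → Y → G} {U : ι → Set Y}

theorem IsFine.mul {f : ℝ → Y} {n m : ℕ} (h : IsFine U f n) (hm : 0 < m) :
    IsFine U f (n * m) := by
  refine ⟨Nat.mul_pos h.1 hm, fun k hk => ?_⟩
  obtain ⟨i, hi⟩ := h.2 (k / m) (Nat.div_lt_of_lt_mul (by rwa [mul_comm]))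
  have hm' : (0 : ℝ) < m := by exact_mod_cast hm
  refine ⟨i, fun t h1 h2 => hi t ?_ ?_⟩
  · have : ((k / m : ℕ) : ℝ) * m ≤ k := by exact_mod_cast Nat.div_mul_le_self k m
    push_cast at h1
    nlinarith
  · have : (k : ℝ) + 1 ≤ ((k / m : ℕ) + 1) * m := by
      exact_mod_cast Nat.lt_div_mul_add hm |>.trans_eq (by ring)
    push_cast at h2
    nlinarith

theorem seqProd_isFine_mul
    (hg : ∀ i, ∀ a ∈ U i, ∀ b ∈ U i, ∀ c ∈ U i, g b c * g a b = g a c)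
    {f : ℝ → Y} {n m : ℕ} (h : IsFine U f n) (hm : 0 < m) :
    seqProd g (fun k => f (k / (n * m : ℕ))) (n * m) = seqProd g (fun k => f (k / n)) n := by
  have hm' : (0 : ℝ) < m := by exact_mod_cast hm
  have hn' : (0 : ℝ) < n := by exact_mod_cast h.1
  rw [seqProd_mul hg]
  · refine seqProd_congr fun k _ => congrArg f ?_
    push_cast
    field_simp
  · intro k hk
    obtain ⟨i, hi⟩ := h.2 k hk
    refine ⟨i, fun j hj => hi _ ?_ ?_⟩
    · push_cast
      rw [show ((k : ℝ) * m + j) / (n * m) * n = k + j / m by field_simp]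
      have : (0 : ℝ) ≤ j / m := by positivity
      linarith
    · push_cast
      rw [show ((k : ℝ) * m + j) / (n * m) * n = k + j / m by field_simp]
      have : (j : ℝ) / m ≤ 1 := (div_le_one hm').2 (by exact_mod_cast hj)
      linarith

/-- Both products equal the one over the common refinement into `n * m` pieces. -/
theorem seqProd_eq_of_isFine
    (hg : ∀ i, ∀ a ∈ U i, ∀ b ∈ U i, ∀ c ∈ U i, g b c * g a b = g a c)
    {f : ℝ → Y} {n m : ℕ} (hn : IsFine U f n) (hm : IsFine U f m) :
    seqProd g (fun k => f (k / n)) n = seqProd g (fun k => f (k / m)) m := by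
  rw [← seqProd_isFine_mul hg hn hm.1, ← seqProd_isFine_mul hg hm hn.1, mul_comm n m]

end Subdivision

section Extend

variable {ι Y G : Type*} [TopologicalSpace Y] [Group G] {g : Y → Y → G} {U : ι → Set Y}

theorem exists_isFine (hU : ∀ i, IsOpen (U i)) (hcov : ∀ y, ∃ i, y ∈ U i)
    {f : ℝ → Y} (hf : Continuous f) : ∃ n, IsFine U f n := by
  obtain ⟨n, hn, h⟩ := exists_fine_grid hU hcov (f := fun q => f q.2) (hf.comp continuous_snd)
  refine ⟨n, hn, fun k hk => ?_⟩
  obtain ⟨i, hi⟩ := h 0 hn k hk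
  exact ⟨i, fun t h1 h2 => hi 0 t (by simp) (by simp) h1 h2⟩

theorem extend_trans_eq {x y z : Y} (p : Path x y) (q : Path y z) {t : ℝ} (h0 : 0 ≤ t)
    (h1 : t ≤ 1) :
    (p.trans q).extend t = if t ≤ 1 / 2 then p.extend (2 * t) else q.extend (2 * t - 1) := by
  rw [Path.extend_apply _ ⟨h0, h1⟩]
  rfl

theorem extend_trans_left {x y z : Y} (p : Path x y) (q : Path y z) {t : ℝ} (h0 : 0 ≤ t)
    (h1 : t ≤ 1 / 2) : (p.trans q).extend t = p.extend (2 * t) := by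
  rw [extend_trans_eq p q h0 (h1.trans (by norm_num)), if_pos h1]

theorem extend_trans_right {x y z : Y} (p : Path x y) (q : Path y z) {t : ℝ} (h0 : 1 / 2 ≤ t)
    (h1 : t ≤ 1) : (p.trans q).extend t = q.extend (2 * t - 1) := by
  rw [extend_trans_eq p q (le_trans (by norm_num) h0) h1]
  split_ifs with h
  · obtain rfl : t = 1 / 2 := le_antisymm h h0
    norm_num
  · rfl

theorem IsFine.trans {x y z : Y} {p : Path x y} {q : Path y z} {n : ℕ}
    (hp : IsFine U p.extend n) (hq : IsFine U q.extend n) :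
    IsFine U (p.trans q).extend (n + n) := by
  have hn : (0 : ℝ) < n := by exact_mod_cast hp.1
  refine ⟨Nat.add_pos_left hp.1 n, fun k hk => ?_⟩
  rcases lt_or_ge k n with hkn | hkn
  · obtain ⟨i, hi⟩ := hp.2 k hkn
    refine ⟨i, fun t h1 h2 => ?_⟩
    push_cast at h1 h2
    have hk' : (k : ℝ) + 1 ≤ n := by exact_mod_cast hkn
    have hk0 : (0 : ℝ) ≤ k := k.cast_nonneg
    rw [extend_trans_left p q (by by_contra!; nlinarith) (by by_contra!; nlinarith)]
    exact hi _ (by linarith) (by linarith)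
  · obtain ⟨l, rfl⟩ := Nat.exists_eq_add_of_le hkn
    obtain ⟨i, hi⟩ := hq.2 l (by omega)
    refine ⟨i, fun t h1 h2 => ?_⟩
    push_cast at h1 h2
    have hk' : (l : ℝ) + 1 ≤ n := by exact_mod_cast (by omega : l + 1 ≤ n)
    have hk0 : (0 : ℝ) ≤ l := l.cast_nonneg
    rw [extend_trans_right p q (by by_contra!; nlinarith) (by by_contra!; nlinarith)]
    exact hi _ (by linarith) (by linarith)

theorem seqProd_trans {x y z : Y} (p : Path x y) (q : Path y z) {n : ℕ} (hn : 0 < n) :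
    seqProd g (fun k => (p.trans q).extend (k / (n + n : ℕ))) (n + n) =
      seqProd g (fun k => q.extend (k / n)) n * seqProd g (fun k => p.extend (k / n)) n := by
  have hn' : (0 : ℝ) < n := by exact_mod_cast hn
  rw [seqProd_add]
  congr 1
  · refine seqProd_congr fun k hk => ?_
    have hk' : (k : ℝ) ≤ n := by exact_mod_cast hk
    have hk0 : (0 : ℝ) ≤ k := k.cast_nonneg
    push_cast
    rw [extend_trans_right p q]
    · congr 1; field_simp; ring
    · rw [div_le_div_iff₀ (by norm_num) (by positivity)]; linarith
    · rw [div_le_one (by positivity)]; linarith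
  · refine seqProd_congr fun k hk => ?_
    have hk' : (k : ℝ) ≤ n := by exact_mod_cast hk
    push_cast
    rw [extend_trans_left p q (by positivity)]
    · congr 1; field_simp; ring
    · rw [div_le_div_iff₀ (by positivity) (by norm_num)]; linarith

/-- On a fine grid for the homotopy, adjacent rows form a ladder. The vertical sides are constant,
so the outer rungs contribute `1` and all rows have the same product. -/
theorem seqProd_homotopy (hU : ∀ i, IsOpen (U i)) (hcov : ∀ y, ∃ i, y ∈ U i)
    (hg : ∀ i, ∀ a ∈ U i, ∀ b ∈ U i, ∀ c ∈ U i, g b c * g a b = g a c)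
    {x y : Y} {p q : Path x y} (F : p.Homotopy q) :
    ∃ n, IsFine U p.extend n ∧ IsFine U q.extend n ∧
      seqProd g (fun k => p.extend (k / n)) n = seqProd g (fun k => q.extend (k / n)) n := by
  let pr : ℝ → I := projIcc (0 : ℝ) 1 zero_le_one
  have hpr : Continuous pr := continuous_projIcc
  obtain ⟨n, hn, h⟩ := exists_fine_grid hU hcov (f := fun a : ℝ × ℝ => F (pr a.1, pr a.2))
    (F.continuous.comp ((hpr.comp continuous_fst).prodMk (hpr.comp continuous_snd)))
  have hn' : (0 : ℝ) < n := by exact_mod_cast hn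
  have h0 : ∀ t, F (pr 0, pr t) = p.extend t := fun t => by
    have : pr 0 = 0 := projIcc_left _
    rw [this, F.apply_zero]; rfl
  have h1 : ∀ t, F (pr 1, pr t) = q.extend t := fun t => by
    have : pr 1 = 1 := projIcc_right _
    rw [this, F.apply_one]; rfl
  have hl : ∀ s, F (pr s, pr 0) = x := fun s => by
    have : pr 0 = 0 := projIcc_left _
    rw [this]; exact F.source _
  have hr : ∀ s, F (pr s, pr 1) = y := fun s => by
    have : pr 1 = 1 := projIcc_right _
    rw [this]; exact F.target _
  have hself : ∀ a, g a a = 1 := fun a => by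
    obtain ⟨i, hi⟩ := hcov a
    exact cocycle_self hg hi
  refine ⟨n, ⟨hn, fun k hk => ?_⟩, ⟨hn, fun k hk => ?_⟩, ?_⟩
  · obtain ⟨i, hi⟩ := h 0 hn k hk
    refine ⟨i, fun t ht ht' => ?_⟩
    rw [← h0]
    exact hi 0 t (by simp) (by simp) ht ht'
  -- The side `s = 1` is the upper edge of the last row of cells, which has index `n - 1`.
  · obtain ⟨i, hi⟩ := h (n - 1) (Nat.sub_lt hn one_pos) k hk
    refine ⟨i, fun t ht ht' => ?_⟩
    rw [← h1]
    have e : ((n - 1 : ℕ) : ℝ) = n - 1 := by rw [Nat.cast_sub hn, Nat.cast_one]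
    exact hi 1 t (by rw [e]; linarith) (by rw [e]; linarith) ht ht'
  · have rows : ∀ j ≤ n, seqProd g (fun k => F (pr (j / n), pr (k / n))) n =
        seqProd g (fun k => p.extend (k / n)) n := by
      intro j hj
      induction j with
      | zero => simp [h0]
      | succ j ih =>
        rw [← ih (by omega)]
        have := seqProd_ladder hg (u := fun k : ℕ => F (pr (j / n), pr (k / n)))
          (w := fun k : ℕ => F (pr ((j + 1 : ℕ) / n), pr (k / n))) (n := n)
          (by simp only [Nat.cast_zero, zero_div, hl, hself]) (fun k hk => by
            obtain ⟨i, hi⟩ := h j (by omega) k hk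
            have e : ∀ j : ℕ, (j : ℝ) / n * n = j := fun j => by field_simp
            have e' : ∀ j : ℕ, ((j + 1 : ℕ) : ℝ) / n * n = j + 1 := fun j => by
              rw [e, Nat.cast_succ]
            have l : ∀ j : ℕ, (j : ℝ) ≤ j + 1 := fun j => by linarith
            exact ⟨i, hi _ _ (e j).ge ((e j).trans_le (l j)) (e k).ge ((e k).trans_le (l k)),
              hi _ _ (e j).ge ((e j).trans_le (l j)) ((l k).trans_eq (e' k).symm) (e' k).le,
              hi _ _ ((l j).trans_eq (e' j).symm) (e' j).le (e k).ge ((e k).trans_le (l k)),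
              hi _ _ ((l j).trans_eq (e' j).symm) (e' j).le ((l k).trans_eq (e' k).symm) (e' k).le⟩)
        rw [← this]
        simp only [div_self hn'.ne', hr, hself, one_mul]
    rw [← rows n le_rfl]
    simp only [div_self hn'.ne', h1]

/-- A cocycle defined on the members of an open cover extends to all paths. -/
theorem exists_pathHom_of_cocycle (hU : ∀ i, IsOpen (U i)) (hcov : ∀ y, ∃ i, y ∈ U i)
    (hg : ∀ i, ∀ a ∈ U i, ∀ b ∈ U i, ∀ c ∈ U i, g b c * g a b = g a c) :
    ∃ T : PathHom Y G, ∀ i {x y : Y} (p : Path x y), (∀ t, p t ∈ U i) → T p = g x y := by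
  have hfine : ∀ {x y : Y} (p : Path x y), ∃ n, IsFine U p.extend n := fun p =>
    exists_isFine hU hcov p.continuous_extend
  choose N hN using @hfine
  refine ⟨{ toFun := fun p => seqProd g (fun k => p.extend (k / N p)) (N p)
            map_homotopic := ?_
            map_trans := ?_ }, ?_⟩
  · rintro x y p q ⟨F⟩
    obtain ⟨n, hp, hq, h⟩ := seqProd_homotopy hU hcov hg F
    rw [seqProd_eq_of_isFine hg (hN p) hp, h, seqProd_eq_of_isFine hg hq (hN q)]
  · intro x y z p q
    -- Refine both paths to the same number of pieces, so that the halves of the concatenation are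
    -- subdivided evenly.
    have hp := (hN p).mul (hN q).1
    have hq := (hN q).mul (hN p).1
    rw [mul_comm] at hq
    rw [seqProd_eq_of_isFine hg (hN (p.trans q)) (hp.trans hq), seqProd_trans p q hp.1,
      seqProd_eq_of_isFine hg (hN p) hp, seqProd_eq_of_isFine hg (hN q) hq]
  · intro i x y p h
    have h1 : IsFine U p.extend 1 := ⟨one_pos, fun k _ => ⟨i, fun t _ _ => h _⟩⟩
    change seqProd g (fun k => p.extend (k / N p)) (N p) = g x y
    rw [seqProd_eq_of_isFine hg (hN p) h1]
    simp [seqProd]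

end Extend

/-- Concatenating two adjacent sides of a square is the same as concatenating the other two. -/
theorem PathHom.map_square {Y G : Type*} [TopologicalSpace Y] [Group G] (T : PathHom Y G)
    (f : C(I × I, Y)) {a b c d : Y} (bot : Path a b) (top : Path c d) (left : Path a c)
    (right : Path b d) (hb : ∀ t, bot t = f (0, t)) (ht : ∀ t, top t = f (1, t))
    (hl : ∀ s, left s = f (s, 0)) (hr : ∀ s, right s = f (s, 1)) :
    T right * T bot = T top * T left := by
  obtain rfl : f (0, 0) = a := by rw [← hb, bot.source]
  obtain rfl : f (0, 1) = b := by rw [← hb, bot.target]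
  obtain rfl : f (1, 0) = c := by rw [← ht, top.source]
  obtain rfl : f (1, 1) = d := by rw [← ht, top.target]
  let h (s : I) : Path (s, (0 : I)) (s, (1 : I)) := ⟨⟨fun t => (s, t), by fun_prop⟩, rfl, rfl⟩
  let v (t : I) : Path ((0 : I), t) ((1 : I), t) := ⟨⟨fun s => (s, t), by fun_prop⟩, rfl, rfl⟩
  obtain rfl : bot = (h 0).map f.continuous := Path.ext (funext hb)
  obtain rfl : top = (h 1).map f.continuous := Path.ext (funext ht)
  obtain rfl : left = (v 0).map f.continuous := Path.ext (funext hl)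
  obtain rfl : right = (v 1).map f.continuous := Path.ext (funext hr)
  rw [← T.map_trans, ← T.map_trans, ← Path.map_trans, ← Path.map_trans]
  -- The two routes around the square are already homotopic in the contractible space `I × I`,
  -- before `f` is applied.
  have : ContractibleSpace I := (convex_Icc (0 : ℝ) 1).contractibleSpace ⟨0, by simp⟩
  exact T.map_homotopic ((SimplyConnectedSpace.paths_homotopic _ _).map f)

/-! ### The geometric realization: simplices, segments and open stars. -/

namespace PreAbstractSimplicialComplex

variable {V : Type*} {K : PreAbstractSimplicialComplex V}

theorem mem_of_subset_of_mem {s t : Finset V} (hs : s ∈ K) (hts : t ⊆ s) (ht : t.Nonempty) :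
    t ∈ K :=
  (K.isRelLowerSet_faces hs).2 hts ht

theorem continuous_point {s : Finset V} (hs : s ∈ K) :
    Continuous (ClosedSimplex.point (K := K) (s := s)) :=
  continuous_iff_coinduced_le.2 (le_iSup (fun t : {t : Finset V // t ∈ K} =>
    TopologicalSpace.coinduced (ClosedSimplex.point (K := K) (s := t.1)) inferInstance) ⟨s, hs⟩)

theorem continuous_realization_iff {Z : Type*} [TopologicalSpace Z] {f : K.Realization → Z} :
    Continuous f ↔ ∀ s ∈ K, Continuous fun x : K.ClosedSimplex s => f x.point :=
  ⟨fun h _ hs => h.comp (continuous_point hs),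
    fun h => continuous_iSup_dom.2 fun s => continuous_coinduced_dom.2 (h s.1 s.2)⟩

theorem ClosedSimplex.continuous_coord (s : Finset V) (v : V) :
    Continuous fun x : K.ClosedSimplex s => x.point.coord v :=
  (continuous_apply v).comp continuous_induced_dom

theorem ClosedSimplex.continuous_mk_iff {Z : Type*} [TopologicalSpace Z] {s : Finset V}
    {f : Z → K.ClosedSimplex s} : Continuous f ↔ ∀ v, Continuous fun z => (f z).point.coord v :=
  continuous_induced_rng.trans continuous_pi_iff

theorem continuous_coord (v : V) : Continuous fun x : K.Realization => x.coord v :=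
  continuous_realization_iff.2 fun s _ => ClosedSimplex.continuous_coord s v

namespace Realization

theorem support_nonempty (x : K.Realization) : x.coord.support.Nonempty :=
  (K.isRelLowerSet_faces x.support_mem).1

/-- The point of `|K|` with given coordinates supported in a face. -/
noncomputable def ofCoord (c : V →₀ ℝ) {s : Finset V} (hs : s ∈ K) (hc : c.support ⊆ s) (h0 : ∀ v, 0 ≤ c v)
    (h1 : (c.sum fun _ a => a) = 1) : K.Realization where
  coord := c
  support_mem := mem_of_subset_of_mem hs hc (by
    rw [Finsupp.support_nonempty_iff]
    rintro rfl
    simp at h1)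
  nonneg := h0
  sum_eq_one := h1

theorem sum_mix (a : ℝ) {c d : V →₀ ℝ} (hc : (c.sum fun _ a => a) = 1)
    (hd : (d.sum fun _ a => a) = 1) : ((((1 - a) • c + a • d)).sum fun _ a => a) = 1 := by
  have e : ∀ c : V →₀ ℝ, (c.sum fun _ a => a) = Finsupp.linearCombination ℝ (fun _ => (1 : ℝ)) c :=
    fun c => by simp [Finsupp.linearCombination_apply]
  rw [e] at hc hd ⊢
  rw [map_add, map_smul, map_smul, hc, hd]
  simp

theorem support_mix_subset {c d : V →₀ ℝ} {s : Finset V} (a : ℝ) (hc : c.support ⊆ s)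
    (hd : d.support ⊆ s) : ((1 - a) • c + a • d).support ⊆ s := by
  classical
  exact Finsupp.support_add.trans (Finset.union_subset (Finsupp.support_smul.trans hc)
    (Finsupp.support_smul.trans hd))

theorem mix_nonneg {c d : V →₀ ℝ} {a : ℝ} (ha : a ∈ Icc (0 : ℝ) 1) (hc : ∀ v, 0 ≤ c v)
    (hd : ∀ v, 0 ≤ d v) (v : V) : 0 ≤ ((1 - a) • c + a • d) v := by
  simp only [Finsupp.add_apply, Finsupp.smul_apply, smul_eq_mul]
  exact add_nonneg (mul_nonneg (sub_nonneg.2 ha.2) (hc v)) (mul_nonneg ha.1 (hd v))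

end Realization

/-- Convex combinations in a closed simplex. -/
noncomputable def ClosedSimplex.mix {s : Finset V} (hs : s ∈ K) (x y : K.ClosedSimplex s) (t : I) :
    K.ClosedSimplex s where
  point := .ofCoord ((1 - (t : ℝ)) • x.point.coord + (t : ℝ) • y.point.coord) hs
    (Realization.support_mix_subset _ x.support_subset y.support_subset)
    (Realization.mix_nonneg t.2 x.point.nonneg y.point.nonneg)
    (Realization.sum_mix _ x.point.sum_eq_one y.point.sum_eq_one)
  support_subset := Realization.support_mix_subset _ x.support_subset y.support_subset

theorem ClosedSimplex.mix_coord {s : Finset V} (hs : s ∈ K) (x y : K.ClosedSimplex s) (t : I)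
    (v : V) : (ClosedSimplex.mix hs x y t).point.coord v =
      (1 - (t : ℝ)) * x.point.coord v + t * y.point.coord v := rfl

theorem ClosedSimplex.ext_coord {s : Finset V} {x y : K.ClosedSimplex s}
    (h : ∀ v, x.point.coord v = y.point.coord v) : x = y :=
  ClosedSimplex.ext (Realization.ext (Finsupp.ext h))

theorem ClosedSimplex.continuous_mix {Z : Type*} [TopologicalSpace Z] {s : Finset V} (hs : s ∈ K)
    {x y : Z → K.ClosedSimplex s} {t : Z → I} (hx : Continuous x) (hy : Continuous y)
    (ht : Continuous t) : Continuous fun z => ClosedSimplex.mix hs (x z) (y z) (t z) := by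
  refine ClosedSimplex.continuous_mk_iff.2 fun v => ?_
  simp only [ClosedSimplex.mix_coord]
  have h := ClosedSimplex.continuous_coord (K := K) s v
  have ht' : Continuous fun z => (t z : ℝ) := continuous_subtype_val.comp ht
  exact ((continuous_const.sub ht').mul (h.comp hx)).add (ht'.mul (h.comp hy))

theorem ClosedSimplex.contractibleSpace {s : Finset V} (hs : s ∈ K) (y : K.ClosedSimplex s) :
    ContractibleSpace (K.ClosedSimplex s) := by
  refine contractible_iff_id_nullhomotopic _ |>.2 ⟨y, ⟨⟨⟨fun q => ClosedSimplex.mix hs q.2 y q.1,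
    ClosedSimplex.continuous_mix hs continuous_snd continuous_const continuous_fst⟩,
    fun x => ?_, fun x => ?_⟩⟩⟩
  · exact ClosedSimplex.ext_coord fun v => by simp [ClosedSimplex.mix_coord]
  · exact ClosedSimplex.ext_coord fun v => by simp [ClosedSimplex.mix_coord]

/-- Two paths with the same ends inside one closed simplex are homotopic. -/
theorem homotopic_of_support_subset {s : Finset V} (hs : s ∈ K) {x y : K.Realization}
    (p q : Path x y) (hp : ∀ t, (p t).coord.support ⊆ s) (hq : ∀ t, (q t).coord.support ⊆ s) :
    p.Homotopic q := by
  have hx : x.coord.support ⊆ s := by simpa using hp 0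
  have hy : y.coord.support ⊆ s := by simpa using hp 1
  -- A closed simplex has the topology of its coordinates, which are continuous on `|K|`; so a path
  -- with image in it lifts continuously.
  let lift (r : Path x y) (hr : ∀ t, (r t).coord.support ⊆ s) :
      Path (⟨x, hx⟩ : K.ClosedSimplex s) ⟨y, hy⟩ :=
    { toFun t := ⟨r t, hr t⟩
      continuous_toFun := ClosedSimplex.continuous_mk_iff.2 fun v =>
        (continuous_coord v).comp r.continuous
      source' := by simp
      target' := by simp }
  have := ClosedSimplex.contractibleSpace hs ⟨x, hx⟩
  exact (SimplyConnectedSpace.paths_homotopic (lift p hp) (lift q hq)).map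
    ⟨_, continuous_point hs⟩

/-- Two points of `|K|` lie in a common closed simplex. -/
def SameSimplex (x y : K.Realization) : Prop :=
  ∃ s ∈ K, x.coord.support ⊆ s ∧ y.coord.support ⊆ s

/-- The straight segment between two points of a common closed simplex. -/
noncomputable def segment {x y : K.Realization} (h : SameSimplex x y) : Path x y where
  toFun t := (ClosedSimplex.mix h.choose_spec.1 ⟨x, h.choose_spec.2.1⟩ ⟨y, h.choose_spec.2.2⟩
    t).point
  continuous_toFun := (continuous_point h.choose_spec.1).comp
    (ClosedSimplex.continuous_mix h.choose_spec.1 continuous_const continuous_const continuous_id)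
  source' := Realization.ext (Finsupp.ext fun v => by simp [ClosedSimplex.mix_coord])
  target' := Realization.ext (Finsupp.ext fun v => by simp [ClosedSimplex.mix_coord])

theorem segment_coord {x y : K.Realization} (h : SameSimplex x y) (t : I) :
    (segment h t).coord = (1 - (t : ℝ)) • x.coord + (t : ℝ) • y.coord := rfl

theorem segment_support_subset {x y : K.Realization} (h : SameSimplex x y) {s : Finset V}
    (hx : x.coord.support ⊆ s) (hy : y.coord.support ⊆ s) (t : I) :
    (segment h t).coord.support ⊆ s := by
  rw [segment_coord]
  exact Realization.support_mix_subset _ hx hy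

theorem trans_support_subset {x y z : K.Realization} {p : Path x y} {q : Path y z} {s : Finset V}
    (hp : ∀ t, (p t).coord.support ⊆ s) (hq : ∀ t, (q t).coord.support ⊆ s) (t : I) :
    (p.trans q t).coord.support ⊆ s := by
  rw [Path.trans_apply]
  split_ifs
  · exact hp _
  · exact hq _

/-- The triangle lies in one closed simplex, which is contractible. This is the source of the
cocycle identities on the complex. -/
theorem segment_triangle {G : Type*} [Group G] (T : PathHom K.Realization G)
    {x y z : K.Realization} {s : Finset V} (hs : s ∈ K) (hx : x.coord.support ⊆ s)
    (hy : y.coord.support ⊆ s) (hz : z.coord.support ⊆ s) (hxy : SameSimplex x y)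
    (hyz : SameSimplex y z) (hxz : SameSimplex x z) :
    T (segment hyz) * T (segment hxy) = T (segment hxz) := by
  rw [← T.map_trans]
  exact T.map_homotopic (homotopic_of_support_subset hs _ _
    (trans_support_subset (segment_support_subset hxy hx hy) (segment_support_subset hyz hy hz))
    (segment_support_subset hxz hx hz))

theorem segment_self {G : Type*} [Group G] (T : PathHom K.Realization G)
    {x : K.Realization} (h : SameSimplex x x) : T (segment h) = 1 :=
  mul_eq_left.mp (segment_triangle T x.support_mem subset_rfl subset_rfl subset_rfl h h h)

/-- The open star of a vertex. -/
def openStar (K : PreAbstractSimplicialComplex V) (v : V) : Set K.Realization :=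
  {x | x.coord v ≠ 0}

theorem isOpen_openStar (v : V) : IsOpen (K.openStar v) :=
  isOpen_ne_fun (continuous_coord v) continuous_const

theorem exists_mem_openStar (x : K.Realization) : ∃ v, x ∈ K.openStar v := by
  obtain ⟨v, hv⟩ := x.support_nonempty
  exact ⟨v, Finsupp.mem_support_iff.1 hv⟩

theorem vertex_support (v : V) (hv : {v} ∈ K) : (K.vertex v hv).coord.support = {v} :=
  Finsupp.support_single v one_ne_zero

theorem sameSimplex_vertex {x : K.Realization} {v : V} (hv : {v} ∈ K) (hx : x ∈ K.openStar v) :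
    SameSimplex x (K.vertex v hv) :=
  ⟨x.coord.support, x.support_mem, subset_rfl, by
    rw [vertex_support, Finset.singleton_subset_iff]; exact Finsupp.mem_support_iff.2 hx⟩

/-- The speed of the contraction of the open star towards its vertex. -/
noncomputable def pushSpeed (ε : ℝ) (v : V) (x : K.Realization) : ℝ := min 1 (x.coord v / ε)

theorem pushSpeed_mem {ε : ℝ} (hε : 0 < ε) (v : V) (x : K.Realization) (t : I) :
    (t : ℝ) * pushSpeed ε v x ∈ Icc (0 : ℝ) 1 := by
  have h0 : 0 ≤ pushSpeed ε v x := le_min zero_le_one (div_nonneg (x.nonneg v) hε.le)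
  have h1 : pushSpeed ε v x ≤ 1 := min_le_left _ _
  exact ⟨mul_nonneg t.2.1 h0, mul_le_one₀ t.2.2 h0 h1⟩

/-- The speed vanishes when `v` is not in the carrier of `x`, so the push never leaves the carrier
and makes sense on all of `|K|`, not only on the star. -/
theorem push_support {ε : ℝ} {v : V} {x : K.Realization} {s : Finset V} (t : I)
    (hx : x.coord.support ⊆ s) :
    ((1 - (t : ℝ) * pushSpeed ε v x) • x.coord +
      ((t : ℝ) * pushSpeed ε v x) • Finsupp.single v 1).support ⊆ s := by
  by_cases hv : x.coord v = 0
  · simpa [pushSpeed, hv] using hx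
  · refine Realization.support_mix_subset _ hx ?_
    rw [Finsupp.support_single v one_ne_zero, Finset.singleton_subset_iff]
    exact hx (Finsupp.mem_support_iff.2 hv)

/-- The move of `x` towards the vertex `v` at time `t`, with speed proportional to the coordinate
of `x` at `v` as long as this is at most `ε`. -/
noncomputable def push {ε : ℝ} (hε : 0 < ε) (v : V) (x : K.Realization) (t : I) :
    K.Realization :=
  .ofCoord ((1 - (t : ℝ) * pushSpeed ε v x) • x.coord +
      ((t : ℝ) * pushSpeed ε v x) • Finsupp.single v 1) x.support_mem
    (push_support t subset_rfl)
    (Realization.mix_nonneg (pushSpeed_mem hε v x t) x.nonneg (fun w => by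
      classical rw [Finsupp.single_apply]; split_ifs <;> norm_num))
    (Realization.sum_mix _ x.sum_eq_one (by simp))

theorem push_coord {ε : ℝ} (hε : 0 < ε) (v : V) (x : K.Realization) (t : I) (w : V) :
    (push hε v x t).coord w = (1 - (t : ℝ) * pushSpeed ε v x) * x.coord w +
      ((t : ℝ) * pushSpeed ε v x) * Finsupp.single v (1 : ℝ) w := rfl

theorem push_zero {ε : ℝ} (hε : 0 < ε) (v : V) (x : K.Realization) : push hε v x 0 = x :=
  Realization.ext (Finsupp.ext fun w => by simp [push_coord])

theorem push_one {ε : ℝ} (hε : 0 < ε) (v : V) (hv : {v} ∈ K) {x : K.Realization}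
    (hx : ε ≤ x.coord v) : push hε v x 1 = K.vertex v hv := by
  have h : pushSpeed ε v x = 1 := min_eq_left ((one_le_div hε).2 hx)
  exact Realization.ext (Finsupp.ext fun w => by simp [push_coord, h, vertex])

/-- The weak topology does not directly test continuity on a product with `I`. Currying to a map
into `C(I, |K|)` reduces it to closed simplices, and local compactness of `I` allows uncurrying. -/
theorem continuous_push {ε : ℝ} (hε : 0 < ε) (v : V) :
    Continuous fun q : K.Realization × I => push hε v q.1 q.2 := by
  have aux : ∀ s ∈ K, Continuous fun q : K.ClosedSimplex s × I => push hε v q.1.point q.2 := by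
    intro s hs
    refine (continuous_point hs).comp (g := ClosedSimplex.point) (f := fun q :
      K.ClosedSimplex s × I => (⟨push hε v q.1.point q.2, push_support q.2 q.1.support_subset⟩ :
        K.ClosedSimplex s)) ?_
    refine ClosedSimplex.continuous_mk_iff.2 fun w => ?_
    simp only [push_coord, pushSpeed]
    have hc : ∀ w, Continuous fun q : K.ClosedSimplex s × I => q.1.point.coord w := fun w =>
      (ClosedSimplex.continuous_coord s w).comp continuous_fst
    have hm : Continuous fun q : K.ClosedSimplex s × I =>
        (q.2 : ℝ) * min 1 (q.1.point.coord v / ε) :=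
      (continuous_subtype_val.comp continuous_snd).mul
        (continuous_const.min ((hc v).div_const ε))
    exact ((continuous_const.sub hm).mul (hc w)).add (hm.mul continuous_const)
  have hsec : ∀ x : K.Realization, Continuous fun t : I => push hε v x t := fun x =>
    (aux _ x.support_mem).comp (f := fun t : I => ((⟨x, subset_rfl⟩ : K.ClosedSimplex _), t))
      (by fun_prop)
  let F : K.Realization → C(I, K.Realization) := fun x => ⟨fun t => push hε v x t, hsec x⟩
  have hF : Continuous F := continuous_realization_iff.2 fun s hs =>
    (ContinuousMap.curry ⟨_, aux s hs⟩).continuous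
  exact ContinuousMap.continuous_uncurry_of_continuous ⟨F, hF⟩

/-- A path in the open star of `v` is homotopic to the broken line through `v`. -/
theorem map_eq_of_mem_openStar {G : Type*} [Group G] (T : PathHom K.Realization G) {v : V}
    (hv : {v} ∈ K) {x y : K.Realization} (p : Path x y) (hp : ∀ t, p t ∈ K.openStar v)
    (hx : SameSimplex x (K.vertex v hv)) (hy : SameSimplex y (K.vertex v hv)) :
    T (segment hy) * T p = T (segment hx) := by
  -- With `ε` the minimum of the coordinate at `v` along the compact path, every point of the path
  -- has reached `v` at time `1`.
  obtain ⟨t₀, -, ht₀⟩ := isCompact_univ.exists_isMinOn (univ_nonempty (α := I))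
    ((continuous_coord v).comp p.continuous).continuousOn
  have hε : 0 < (p t₀).coord v := ((p t₀).nonneg v).lt_of_ne' (hp t₀)
  have hmin : ∀ t, (p t₀).coord v ≤ (p t).coord v := fun t => ht₀ (mem_univ t)
  have hone : ∀ t, push hε v (p t) 1 = K.vertex v hv := fun t => push_one hε v hv (hmin t)
  let track (z : K.Realization) (hz : ∃ t, p t = z) : Path z (K.vertex v hv) :=
    { toFun s := push hε v z s
      continuous_toFun := (continuous_push hε v).comp (f := fun s => (z, s)) (by fun_prop)
      source' := push_zero hε v z
      target' := by obtain ⟨t, rfl⟩ := hz; exact hone t }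
  have htrack : ∀ (z : K.Realization) (hz : ∃ t, p t = z)
      (h : SameSimplex z (K.vertex v hv)), T (track z hz) = T (segment h) := by
    intro z hz h
    have hvz : v ∈ z.coord.support := by
      obtain ⟨t, rfl⟩ := hz
      exact Finsupp.mem_support_iff.2 (hp t)
    refine T.map_homotopic (homotopic_of_support_subset z.support_mem _ _
      (fun s => push_support s subset_rfl) (segment_support_subset h subset_rfl ?_))
    rwa [vertex_support, Finset.singleton_subset_iff]
  -- The square has `p` at the bottom, the constant path at `v` on top and the tracks of the two
  -- ends as sides.
  have := T.map_square ⟨fun q : I × I => push hε v (p q.2) q.1,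
      (continuous_push hε v).comp (f := fun q : I × I => (p q.2, q.1)) (by fun_prop)⟩
    p (Path.refl (K.vertex v hv)) (track x ⟨0, p.source⟩) (track y ⟨1, p.target⟩)
    (fun t => (push_zero hε v _).symm) (fun t => (hone t).symm)
    (fun s => by simp [track]) (fun s => by simp [track])
  rwa [T.map_refl, one_mul, htrack x ⟨0, p.source⟩ hx, htrack y ⟨1, p.target⟩ hy] at this

end PreAbstractSimplicialComplex

/-! ### Path components, paths in subsets, and chosen carrier vertices. -/

/-- A property that is constant on each member of an open cover is constant on path components. -/
theorem Joined.of_local {ι Y : Type*} [TopologicalSpace Y] {U : ι → Set Y}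
    (hU : ∀ i, IsOpen (U i)) (hcov : ∀ y, ∃ i, y ∈ U i) {P : Y → Prop}
    (hP : ∀ i, ∀ a ∈ U i, ∀ b ∈ U i, P a → P b) {x y : Y} (h : Joined x y) (hx : P x) : P y := by
  obtain ⟨p⟩ := h
  have hclopen : IsClopen {z | P z} := by
    refine ⟨isOpen_compl_iff.1 (isOpen_iff_forall_mem_open.2 fun a ha => ?_),
      isOpen_iff_forall_mem_open.2 fun a ha => ?_⟩
    · obtain ⟨i, hi⟩ := hcov a
      exact ⟨U i, fun b hb hPb => ha (hP i b hb a hi hPb), hU i, hi⟩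
    · obtain ⟨i, hi⟩ := hcov a
      exact ⟨U i, fun b hb => hP i a hi b hb ha, hU i, hi⟩
  exact (isPreconnected_range p.continuous).subset_isClopen hclopen
    ⟨x, ⟨0, p.source⟩, hx⟩ ⟨1, p.target⟩

/-- Lift of a path to a subset containing it. -/
def Path.liftSubtype {Y : Type*} [TopologicalSpace Y] {s : Set Y} {x y : Y} (p : Path x y)
    (hp : ∀ t, p t ∈ s) (hx : x ∈ s) (hy : y ∈ s) : Path (⟨x, hx⟩ : s) ⟨y, hy⟩ where
  toFun t := ⟨p t, hp t⟩
  continuous_toFun := p.continuous.subtype_mk hp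
  source' := Subtype.ext p.source
  target' := Subtype.ext p.target

theorem IsSimplyConnected.homotopic {Y : Type*} [TopologicalSpace Y] {s : Set Y}
    (hs : IsSimplyConnected s) {x y : Y} (p q : Path x y) (hp : ∀ t, p t ∈ s)
    (hq : ∀ t, q t ∈ s) : p.Homotopic q := by
  have := hs.simplyConnectedSpace
  have hx : x ∈ s := by simpa using hp 0
  have hy : y ∈ s := by simpa using hp 1
  exact (SimplyConnectedSpace.paths_homotopic (p.liftSubtype hp hx hy)
    (q.liftSubtype hq hx hy)).map ⟨_, continuous_subtype_val⟩

theorem Path.trans_mem {Y : Type*} [TopologicalSpace Y] {s : Set Y} {x y z : Y} {p : Path x y}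
    {q : Path y z} (hp : ∀ t, p t ∈ s) (hq : ∀ t, q t ∈ s) (t : I) : p.trans q t ∈ s := by
  rw [Path.trans_apply]
  split_ifs
  · exact hp _
  · exact hq _

namespace PreAbstractSimplicialComplex

variable {V : Type*} {K : PreAbstractSimplicialComplex V}

theorem segment_mem_openStar {x y : K.Realization} (h : SameSimplex x y) {v : V}
    (hx : x ∈ K.openStar v) (hy : y ∈ K.openStar v) (t : I) : segment h t ∈ K.openStar v := by
  have hx' : 0 < x.coord v := (x.nonneg v).lt_of_ne' hx
  have hy' : 0 < y.coord v := (y.nonneg v).lt_of_ne' hy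
  change (1 - (t : ℝ)) * x.coord v + t * y.coord v ≠ 0
  have h0 := t.2.1
  have h1 := t.2.2
  rcases h0.eq_or_lt with h | h
  · rw [← h, sub_zero, one_mul, zero_mul, add_zero]; exact hx
  · have := mul_pos h hy'
    have := mul_nonneg (sub_nonneg.2 h1) hx'.le
    linarith

theorem segment_half_mem_openStar {x y : K.Realization} (h : SameSimplex x y) {v : V}
    (hv : x ∈ K.openStar v ∨ y ∈ K.openStar v) :
    segment h ⟨1 / 2, by norm_num, by norm_num⟩ ∈ K.openStar v := by
  have hx := x.nonneg v
  have hy := y.nonneg v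
  change (1 - (1 / 2 : ℝ)) * x.coord v + (1 / 2) * y.coord v ≠ 0
  rcases hv with hv | hv
  · have : 0 < x.coord v := hx.lt_of_ne' hv
    linarith
  · have : 0 < y.coord v := hy.lt_of_ne' hv
    linarith

theorem vertex_mem_openStar (v : V) (hv : {v} ∈ K) : K.vertex v hv ∈ K.openStar v := by
  simp [openStar, vertex]

theorem segment_of_eq {G : Type*} [Group G] (T : PathHom K.Realization G)
    {x y : K.Realization} (h : SameSimplex x y) (e : x = y) : T (segment h) = 1 := by
  subst e
  exact segment_self T h

/-- A chosen vertex of the carrier of a point. -/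
noncomputable def carrierVertex (x : K.Realization) : V := x.support_nonempty.choose

theorem carrierVertex_mem (x : K.Realization) : carrierVertex x ∈ x.coord.support :=
  x.support_nonempty.choose_spec

theorem carrierVertex_vertex (v : V) (hv : {v} ∈ K) : carrierVertex (K.vertex v hv) = v := by
  have := carrierVertex_mem (K.vertex v hv)
  rwa [vertex_support, Finset.mem_singleton] at this

end PreAbstractSimplicialComplex

/-! ### Comparison of `X` with its Rips complexes. -/

section Rips

variable {X : Type*} [MetricSpace X] {r : ℝ}

theorem dist_lt_of_mem_rips {s : Finset X} (hs : s ∈ ripsComplex X r) {x y : X} (hx : x ∈ s)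
    (hy : y ∈ s) : dist x y < r :=
  (Metric.dist_le_diam_of_mem s.finite_toSet.isBounded hx hy).trans_lt hs.2

open Classical in
theorem triple_mem_rips {x y z : X} (hxy : dist x y < r) (hxz : dist x z < r)
    (hyz : dist y z < r) : ({x, y, z} : Finset X) ∈ ripsComplex X r := by
  refine ⟨⟨x, by simp⟩, ?_⟩
  rw [Finset.coe_insert, Finset.coe_insert, Finset.coe_singleton, Metric.diam_triple]
  exact max_lt (max_lt hxy hxz) hyz

theorem singleton_mem_rips (hr : 0 < r) (x : X) : {x} ∈ ripsComplex X r :=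
  ⟨Finset.singleton_nonempty x, by simpa using hr⟩

theorem ripsVertex_support (hr : 0 < r) (x : X) : (ripsVertex hr x).coord.support = {x} :=
  vertex_support x _

theorem sameSimplex_rips (hr : 0 < r) {x y : X} (h : dist x y < r) :
    SameSimplex (ripsVertex hr x) (ripsVertex hr y) := by
  classical
  -- An edge is treated as a degenerate triangle.
  refine ⟨{x, y, y}, triple_mem_rips h h (by simpa using hr), ?_, ?_⟩ <;>
    simp [ripsVertex_support]

/-- The edge between two points at distance less than `r`. -/
noncomputable def ripsEdge (hr : 0 < r) {x y : X} (h : dist x y < r) :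
    Path (ripsVertex hr x) (ripsVertex hr y) :=
  segment (sameSimplex_rips hr h)

variable {G : Type*} [Group G]

theorem ripsEdge_triangle (hr : 0 < r) (T : PathHom (ripsComplex X r).Realization G) {x y z : X}
    (hxy : dist x y < r) (hyz : dist y z < r) (hxz : dist x z < r) :
    T (ripsEdge hr hyz) * T (ripsEdge hr hxy) = T (ripsEdge hr hxz) := by
  classical
  refine segment_triangle T (triple_mem_rips hxy hxz hyz) ?_ ?_ ?_ _ _ _ <;>
    simp [ripsVertex_support]

/-- Points of a ball of radius `r / 2` are pairwise at distance less than `r`, so any three span a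
simplex and the edge values form a cocycle. -/
theorem exists_pathHom_of_rips (hr : 0 < r) (T : PathHom (ripsComplex X r).Realization G) :
    ∃ S : PathHom X G, ∀ (c : X) {x y : X} (p : Path x y), (∀ t, p t ∈ Metric.ball c (r / 2)) →
      ∀ h : dist x y < r, S p = T (ripsEdge hr h) := by
  classical
  have hd : ∀ c : X, ∀ x ∈ Metric.ball c (r / 2), ∀ y ∈ Metric.ball c (r / 2), dist x y < r := by
    intro c x hx y hy
    have := dist_triangle_right x y c
    rw [Metric.mem_ball] at hx hy
    linarith
  obtain ⟨S, hS⟩ := exists_pathHom_of_cocycle (U := fun c : X => Metric.ball c (r / 2))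
    (g := fun x y => if h : dist x y < r then T (ripsEdge hr h) else 1)
    (fun _ => Metric.isOpen_ball) (fun x => ⟨x, Metric.mem_ball_self (half_pos hr)⟩)
    (fun c x hx y hy z hz => by
      rw [dif_pos (hd c y hy z hz), dif_pos (hd c x hx y hy), dif_pos (hd c x hx z hz)]
      exact ripsEdge_triangle hr T _ _ _)
  exact ⟨S, fun c x y p hp h => by rw [hS c p hp, dif_pos h]⟩

/-- The restriction of `T` from `|Rips(X, r)|` to `X`, replacing short paths by edges. -/
noncomputable def ripsRestrict (hr : 0 < r) (T : PathHom (ripsComplex X r).Realization G) :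
    PathHom X G :=
  (exists_pathHom_of_rips hr T).choose

theorem ripsRestrict_eq (hr : 0 < r) (T : PathHom (ripsComplex X r).Realization G) (c : X)
    {x y : X} (p : Path x y) (hp : ∀ t, p t ∈ Metric.ball c (r / 2)) (h : dist x y < r) :
    ripsRestrict hr T p = T (ripsEdge hr h) :=
  (exists_pathHom_of_rips hr T).choose_spec c p hp h

theorem dist_lt_of_path_mem {c x y : X} (p : Path x y) (hp : ∀ t, p t ∈ Metric.ball c (r / 2)) :
    dist x y < r := by
  have hx : dist x c < r / 2 := by simpa using hp 0
  have hy : dist y c < r / 2 := by simpa using hp 1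
  have := dist_triangle_right x y c
  linarith

/-- On a path in the ball of radius `r` about `v`, the restriction is the broken line through
`v`. -/
theorem ripsRestrict_of_mem_ball (hr : 0 < r) (T : PathHom (ripsComplex X r).Realization G)
    {v x y : X} (p : Path x y) (hp : ∀ t, p t ∈ Metric.ball v r) (hx : dist x v < r)
    (hy : dist y v < r) :
    ripsRestrict hr T p = (T (ripsEdge hr hy))⁻¹ * T (ripsEdge hr hx) := by
  -- Inside the ball every point has an edge to `v`. The triangle on the ends of a short path and
  -- `v` shows that the restriction is the coboundary of these edges.
  have key := PathHom.eq_of_local (Y := Metric.ball v r)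
    (U := fun c : X => Subtype.val ⁻¹' Metric.ball c (r / 2))
    (fun _ => Metric.isOpen_ball.preimage continuous_subtype_val)
    (fun x => ⟨x.1, Metric.mem_ball_self (half_pos hr)⟩)
    ((ripsRestrict hr T).comap ⟨_, continuous_subtype_val⟩) PathHom.trivial
    (fun z => (T (ripsEdge hr (Metric.mem_ball.1 z.2)))⁻¹) ⟨x, hx⟩
    (fun c a b q _ hq => by
      have hab := dist_lt_of_path_mem (q.map continuous_subtype_val) hq
      refine (ripsRestrict_eq hr T c (q.map continuous_subtype_val) hq hab).trans ?_
      have := ripsEdge_triangle hr T hab (Metric.mem_ball.1 b.2) (Metric.mem_ball.1 a.2)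
      rw [← this]
      simp [PathHom.trivial])
    (p.liftSubtype hp hx hy) (Joined.refl _)
  refine Eq.trans ?_ (key.trans ?_)
  · rfl
  · simp [PathHom.trivial]

theorem carrierVertex_mem_ball {v : X} {x : (ripsComplex X r).Realization}
    (hx : x ∈ (ripsComplex X r).openStar v) : carrierVertex x ∈ Metric.ball v r :=
  Metric.mem_ball.2 (dist_lt_of_mem_rips x.support_mem (carrierVertex_mem x)
    (Finsupp.mem_support_iff.2 hx))

theorem exists_path_mem_ball {R : ℝ} (hX : SimplyConnectedUpToScale X R) (hr : 0 < r)
    (hrR : r < R) {v x y : X} (hx : x ∈ Metric.ball v r) (hy : y ∈ Metric.ball v r) :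
    ∃ p : Path x y, ∀ t, p t ∈ Metric.ball v r := by
  have h := (hX v r hr hrR).isPathConnected.joinedIn x hx y hy
  exact ⟨h.somePath, h.somePath_mem⟩

/-- Points of the star of `v` have carrier vertices in the ball of radius `r` about `v`. Path
connectedness of this ball provides paths, and concatenating them there gives the cocycle identity.
-/
theorem exists_pathHom_rips {R : ℝ} (hX : SimplyConnectedUpToScale X R) (hr : 0 < r)
    (hrR : 2 * r < R) (S : PathHom X G) :
    ∃ T : PathHom (ripsComplex X r).Realization G, ∀ (v : X) {x y : (ripsComplex X r).Realization}
      (p : Path x y), (∀ t, p t ∈ (ripsComplex X r).openStar v) →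
      ∀ q : Path (carrierVertex x) (carrierVertex y), (∀ t, q t ∈ Metric.ball v r) →
        T p = S q := by
  classical
  let g (a b : X) : G :=
    if h : ∃ p : Path a b, ∀ t, p t ∈ Metric.ball a (2 * r) then S h.choose else 1
  have hg : ∀ {v a b : X} (p : Path a b), (∀ t, p t ∈ Metric.ball v r) → g a b = S p := by
    intro v a b p hp
    -- The larger ball is centred at `a` rather than `v`, so `g a b` does not depend on the star in
    -- which it is used; this is where the factor `2` comes from.
    have hsub : Metric.ball v r ⊆ Metric.ball a (2 * r) := by
      refine Metric.ball_subset_ball' ?_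
      have : dist a v < r := by simpa using hp 0
      rw [dist_comm]
      linarith
    have hex : ∃ p : Path a b, ∀ t, p t ∈ Metric.ball a (2 * r) := ⟨p, fun t => hsub (hp t)⟩
    simp only [g, dif_pos hex]
    exact S.map_homotopic ((hX a (2 * r) (by linarith) hrR).homotopic _ _ hex.choose_spec
      fun t => hsub (hp t))
  obtain ⟨T, hT⟩ := exists_pathHom_of_cocycle (U := fun v : X => (ripsComplex X r).openStar v)
    (g := fun x y => g (carrierVertex x) (carrierVertex y))
    (fun v => isOpen_openStar v) exists_mem_openStar
    (fun v x hx y hy z hz => by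
      obtain ⟨p, hp⟩ := exists_path_mem_ball hX hr (by linarith) (carrierVertex_mem_ball hx)
        (carrierVertex_mem_ball hy)
      obtain ⟨q, hq⟩ := exists_path_mem_ball hX hr (by linarith) (carrierVertex_mem_ball hy)
        (carrierVertex_mem_ball hz)
      rw [hg p hp, hg q hq, hg (p.trans q) (Path.trans_mem hp hq), S.map_trans])
  exact ⟨T, fun v x y p hp q hq => by rw [hT v p hp, hg q hq]⟩

/-- An extension with the property of `exists_pathHom_rips` takes an edge to a short path between
its ends. -/
theorem map_ripsEdge {R : ℝ} (hX : SimplyConnectedUpToScale X R) (hr : 0 < r)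
    (hrR : 2 * r < R) (S : PathHom X G) {T : PathHom (ripsComplex X r).Realization G}
    (hT : ∀ (v : X) {x y : (ripsComplex X r).Realization}
      (p : Path x y), (∀ t, p t ∈ (ripsComplex X r).openStar v) →
      ∀ q : Path (carrierVertex x) (carrierVertex y), (∀ t, q t ∈ Metric.ball v r) → T p = S q)
    {x y : X} (h : dist x y < r) (p : Path x y) (hp : ∀ t, p t ∈ Metric.ball x (2 * r)) :
    T (ripsEdge hr h) = S p := by
  have hs := sameSimplex_rips hr h
  -- An edge need not lie in the star of either end, but its midpoint lies in both stars, so each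
  -- half lies in one.
  set m := segment hs ⟨1 / 2, by norm_num, by norm_num⟩
  have hx : ripsVertex hr x ∈ (ripsComplex X r).openStar x := vertex_mem_openStar x _
  have hy : ripsVertex hr y ∈ (ripsComplex X r).openStar y := vertex_mem_openStar y _
  have hmx : m ∈ (ripsComplex X r).openStar x := segment_half_mem_openStar hs (.inl hx)
  have hmy : m ∈ (ripsComplex X r).openStar y := segment_half_mem_openStar hs (.inr hy)
  obtain ⟨s, hsK, hxs, hys⟩ := id hs
  have hms : m.coord.support ⊆ s := segment_support_subset hs hxs hys _
  have hxm : SameSimplex (ripsVertex hr x) m := ⟨s, hsK, hxs, hms⟩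
  have hmy' : SameSimplex m (ripsVertex hr y) := ⟨s, hsK, hms, hys⟩
  obtain ⟨q₁, hq₁⟩ := exists_path_mem_ball hX hr (by linarith) (carrierVertex_mem_ball hx)
    (carrierVertex_mem_ball hmx)
  obtain ⟨q₂, hq₂⟩ := exists_path_mem_ball hX hr (by linarith) (carrierVertex_mem_ball hmy)
    (carrierVertex_mem_ball hy)
  have ex : carrierVertex (ripsVertex hr x) = x := carrierVertex_vertex x _
  have ey : carrierVertex (ripsVertex hr y) = y := carrierVertex_vertex y _
  rw [ripsEdge, ← segment_triangle T hsK hxs hms hys hxm hmy' hs,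
    hT x _ (segment_mem_openStar hxm hx hmx) q₁ hq₁,
    hT y _ (segment_mem_openStar hmy' hmy hy) q₂ hq₂, ← S.map_trans, ← S.map_cast p ex ey]
  have hsub₁ : Metric.ball x r ⊆ Metric.ball x (2 * r) := Metric.ball_subset_ball (by linarith)
  have hsub₂ : Metric.ball y r ⊆ Metric.ball x (2 * r) := by
    refine Metric.ball_subset_ball' ?_
    rw [dist_comm]
    linarith
  exact S.map_homotopic ((hX x (2 * r) (by linarith) hrR).homotopic _ _
    (Path.trans_mem (fun t => hsub₁ (hq₁ t)) fun t => hsub₂ (hq₂ t)) hp)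

theorem joined_ripsVertex (hr : 0 < r) {x y : X} (h : Joined x y) :
    Joined (ripsVertex hr x) (ripsVertex hr y) := by
  refine Joined.of_local (U := fun c : X => Metric.ball c (r / 2))
    (P := fun y => Joined (ripsVertex hr x) (ripsVertex hr y)) (fun _ => Metric.isOpen_ball)
    (fun x => ⟨x, Metric.mem_ball_self (half_pos hr)⟩) (fun c a ha b hb hP => ?_) h (Joined.refl _)
  have : dist a b < r := by
    have := dist_triangle_right a b c
    rw [Metric.mem_ball] at ha hb
    linarith
  exact hP.trans ⟨ripsEdge hr this⟩

theorem joined_carrierVertex {R : ℝ} (hX : SimplyConnectedUpToScale X R) (hr : 0 < r)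
    (hrR : r < R) {x y : (ripsComplex X r).Realization} (h : Joined x y) :
    Joined (carrierVertex x) (carrierVertex y) := by
  refine Joined.of_local (U := fun v : X => (ripsComplex X r).openStar v)
    (P := fun y => Joined (carrierVertex x) (carrierVertex y)) (fun v => isOpen_openStar v)
    exists_mem_openStar (fun v a ha b hb hP => ?_) h (Joined.refl _)
  obtain ⟨p, -⟩ := exists_path_mem_ball hX hr hrR (carrierVertex_mem_ball ha)
    (carrierVertex_mem_ball hb)
  exact hP.trans ⟨p⟩

/-- The homomorphism `π₁(X) → π₁(Rips(X, r))` replacing short paths by edges. -/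
noncomputable def toRips (hr : 0 < r) (x₀ : X) :
    FundamentalGroup X x₀ →* FundamentalGroup (ripsComplex X r).Realization (ripsVertex hr x₀) :=
  (ripsRestrict hr (PathHom.loop (ripsVertex hr x₀))).toMonoidHom x₀

/-- The extension `T` of `loop x₀` gives a left inverse: a short path goes to an edge, which `T`
takes back to that path, up to the potential of `T` at the ends. -/
theorem toRips_injective {R : ℝ} (hX : SimplyConnectedUpToScale X R) (hr : 0 < r)
    (hrR : 2 * r < R) (x₀ : X) : Function.Injective (toRips hr x₀) := by
  obtain ⟨T, hT⟩ := exists_pathHom_rips hX hr hrR (PathHom.loop x₀)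
  refine Function.LeftInverse.injective (g := T.toMonoidHom (ripsVertex hr x₀)) fun a => ?_
  obtain ⟨p, rfl⟩ := PathHom.loopClass_surjective x₀ a
  have := PathHom.eq_of_local (U := fun c : X => Metric.ball c (r / 2))
    (fun _ => Metric.isOpen_ball) (fun x => ⟨x, Metric.mem_ball_self (half_pos hr)⟩)
    ((ripsRestrict hr (PathHom.loop (ripsVertex hr x₀))).comp (T.toMonoidHom (ripsVertex hr x₀)))
    (PathHom.loop x₀) (fun x => (T.potential (ripsVertex hr x₀) (ripsVertex hr x))⁻¹) x₀
    (fun c x y q hx hq => by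
      have h := dist_lt_of_path_mem q hq
      have hsub : Metric.ball c (r / 2) ⊆ Metric.ball x (2 * r) := by
        refine Metric.ball_subset_ball' ?_
        have : dist x c < r / 2 := by simpa using hq 0
        rw [dist_comm]
        linarith
      change T.toMonoidHom _ (ripsRestrict hr _ q) = _
      rw [ripsRestrict_eq hr _ c q hq h, T.toMonoidHom_loop (joined_ripsVertex hr hx),
        map_ripsEdge hX hr hrR _ hT h q fun t => hsub (hq t), inv_inv])
    p (Joined.refl _)
  rw [T.potential_self, PathHom.loop_apply_loop, inv_one, inv_one, mul_one, one_mul] at this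
  exact this

/-- The same `T` gives a right inverse. The coboundary combines the potential at the carrier vertex
with the segment from the point to this vertex. -/
theorem toRips_surjective {R : ℝ} (hX : SimplyConnectedUpToScale X R) (hr : 0 < r)
    (hrR : 2 * r < R) (x₀ : X) : Function.Surjective (toRips hr x₀) := by
  obtain ⟨T, hT⟩ := exists_pathHom_rips hX hr hrR (PathHom.loop x₀)
  refine Function.RightInverse.surjective (g := T.toMonoidHom (ripsVertex hr x₀)) fun a => ?_
  obtain ⟨p, rfl⟩ := PathHom.loopClass_surjective _ a
  set L := PathHom.loop (ripsVertex hr x₀)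
  set S := ripsRestrict hr L
  have hη : ∀ x : (ripsComplex X r).Realization,
      SameSimplex x (ripsVertex hr (carrierVertex x)) := fun x =>
    sameSimplex_vertex _ (Finsupp.mem_support_iff.1 (carrierVertex_mem x))
  have e₀ : carrierVertex (ripsVertex hr x₀) = x₀ := carrierVertex_vertex x₀ _
  have := PathHom.eq_of_local (U := fun v : X => (ripsComplex X r).openStar v)
    (fun v => isOpen_openStar v) exists_mem_openStar (T.comp (S.toMonoidHom x₀)) L
    (fun x => (S.potential x₀ (carrierVertex x))⁻¹ * L (segment (hη x))) (ripsVertex hr x₀)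
    (fun v x y q hx hq => by
      have hxv : x ∈ (ripsComplex X r).openStar v := by simpa using hq 0
      have hyv : y ∈ (ripsComplex X r).openStar v := by simpa using hq 1
      have hJ : Joined x₀ (carrierVertex x) := by
        have := joined_carrierVertex hX hr (by linarith) hx
        rwa [e₀] at this
      -- The point, its carrier vertex and `v` lie in the carrier of `z`, so a detour through the
      -- carrier vertex does not matter.
      have tri : ∀ z (hz : z ∈ (ripsComplex X r).openStar v),
          L (ripsEdge hr (Metric.mem_ball.1 (carrierVertex_mem_ball hz))) * L (segment (hη z)) =
            L (segment (sameSimplex_vertex (singleton_mem_rips hr v) hz)) := by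
        intro z hz
        refine segment_triangle L z.support_mem subset_rfl ?_ ?_ _ _ _
        · rw [ripsVertex_support, Finset.singleton_subset_iff]
          exact carrierVertex_mem z
        · rw [ripsVertex_support, Finset.singleton_subset_iff]
          exact Finsupp.mem_support_iff.2 hz
      have star := map_eq_of_mem_openStar L (singleton_mem_rips hr v) q hq
        (sameSimplex_vertex _ hxv) (sameSimplex_vertex _ hyv)
      obtain ⟨w, hw⟩ := exists_path_mem_ball hX hr (by linarith) (carrierVertex_mem_ball hxv)
        (carrierVertex_mem_ball hyv)
      change S.toMonoidHom _ (T q) = _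
      rw [hT v q hq w hw, S.toMonoidHom_loop hJ, ripsRestrict_of_mem_ball hr L w hw
        (Metric.mem_ball.1 (carrierVertex_mem_ball hxv))
        (Metric.mem_ball.1 (carrierVertex_mem_ball hyv)), eq_mul_inv_of_mul_eq (tri x hxv),
        eq_mul_inv_of_mul_eq (tri y hyv), ← star]
      group)
    p (Joined.refl _)
  -- At the base point the carrier vertex is forced to be `x₀`, so the segment is constant and the
  -- coboundary disappears.
  rw [segment_of_eq L (hη (ripsVertex hr x₀)) (by rw [e₀]), e₀, S.potential_self,
    PathHom.loop_apply_loop, inv_one, mul_one, inv_one, mul_one, one_mul] at this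
  exact this

theorem toRips_bijective {R : ℝ} (hX : SimplyConnectedUpToScale X R) (hr : 0 < r)
    (hrR : 2 * r < R) (x₀ : X) : Function.Bijective (toRips hr x₀) :=
  ⟨toRips_injective hX hr hrR x₀, toRips_surjective hX hr hrR x₀⟩

theorem mapOfEq_ripsInclusion {r' : ℝ} (hr : 0 < r) (h : r ≤ r') (x₀ : X) :
    FundamentalGroup.mapOfEq (ripsInclusion X h) (ripsInclusion_vertex hr h x₀) =
      ((PathHom.loop (ripsVertex (hr.trans_le h) x₀)).comap (ripsInclusion X h)).toMonoidHom
        (ripsVertex hr x₀) := by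
  ext a
  obtain ⟨p, rfl⟩ := PathHom.loopClass_surjective _ a
  rw [FundamentalGroup.mapOfEq_apply]
  exact (PathHom.loop_apply_loop (y₀ := ripsVertex (hr.trans_le h) x₀)
    (p.map (ripsInclusion X h).continuous)).symm

/-- It suffices to compare paths in balls of radius `r / 2`: both sides use the edge between the
ends, and the inclusion takes edges to edges. -/
theorem mapOfEq_comp_toRips {r' : ℝ} (hr : 0 < r) (h : r ≤ r') (x₀ : X) :
    (FundamentalGroup.mapOfEq (ripsInclusion X h) (ripsInclusion_vertex hr h x₀)).comp
      (toRips hr x₀) = toRips (hr.trans_le h) x₀ := by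
  rw [mapOfEq_ripsInclusion]
  set M := (PathHom.loop (ripsVertex (hr.trans_le h) x₀)).comap (ripsInclusion X h)
  ext a
  obtain ⟨p, rfl⟩ := PathHom.loopClass_surjective _ a
  have := PathHom.eq_of_local (U := fun c : X => Metric.ball c (r / 2))
    (fun _ => Metric.isOpen_ball) (fun x => ⟨x, Metric.mem_ball_self (half_pos hr)⟩)
    ((ripsRestrict hr (PathHom.loop (ripsVertex hr x₀))).comp (M.toMonoidHom (ripsVertex hr x₀)))
    (ripsRestrict (hr.trans_le h) (PathHom.loop (ripsVertex (hr.trans_le h) x₀)))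
    (fun x => (M.potential (ripsVertex hr x₀) (ripsVertex hr x))⁻¹) x₀
    (fun c x y q hx hq => by
      have hd := dist_lt_of_path_mem q hq
      change M.toMonoidHom _ (ripsRestrict hr _ q) = _
      rw [ripsRestrict_eq hr _ c q hq hd, M.toMonoidHom_loop (joined_ripsVertex hr hx),
        ripsRestrict_eq (hr.trans_le h) _ c q
          (fun t => Metric.ball_subset_ball (by linarith) (hq t)) (hd.trans_le h), inv_inv]
      rfl)
    p (Joined.refl _)
  rw [M.potential_self, inv_one, inv_one, mul_one, one_mul] at this
  exact this

end Rips

theorem theorem4p9 {X : Type*} [MetricSpace X] [CompactSpace X] (x₀ : X) (R : ℝ) (hR : 0 < R)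
    (hX : SimplyConnectedUpToScale X R) :
    (∀ (r : ℝ) (hr : 0 < r), r < R / 3 →
      Nonempty (FundamentalGroup (ripsComplex X r).Realization (ripsVertex hr x₀) ≃*
        FundamentalGroup X x₀)) ∧
    (∀ (r r' : ℝ) (hr : 0 < r) (hrr' : r < r'), r' < R / 3 →
      Function.Bijective (FundamentalGroup.mapOfEq (ripsInclusion X hrr'.le)
        (ripsInclusion_vertex hr hrr'.le x₀))) := by
  refine ⟨fun r hr hrR => ⟨(MulEquiv.ofBijective (toRips hr x₀)
    (toRips_bijective hX hr (by linarith) x₀)).symm⟩, fun r r' hr hrr' hrR => ?_⟩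
  have h := toRips_bijective hX hr (by linarith : 2 * r < R) x₀
  -- Precomposing with the bijection at scale `r` turns the inclusion map into the bijection at
  -- scale `r'`.
  rw [← Function.Bijective.of_comp_iff _ h, ← MonoidHom.coe_comp, mapOfEq_comp_toRips hr hrr'.le x₀]
  exact toRips_bijective hX (hr.trans hrr') (by linarith) x₀
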